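/- There are absolute constants $C, c > 0$ with the following property. Let $n, m$ be non-negative integers and let $s \le n$ be a real number, and put $$K_{n,s} = \{z \in \mathbb{R}^n : \|z\|_2 \le 1,\ \|z\|_1 \le \sqrt{s}\}.$$ Let $a_1,\dots,a_m$ be independent standard Gaussian random vectors in $\mathbb{R}^n$, and fix $x \in \mathbb{R}^n$, $x \neq 0$, with $x/\|x\|_2 \in K_{n,s}$ (this forces $s \ge 1$). Suppose that $y_1,\dots,y_m$ follow the logistic regression model: given $a_1,\dots,a_m$, the $y_i$ are independent $\{-1,1\}$-valued random variables with $$\mathbb{P}(y_i = 1 \mid a_1,\dots,a_m) = f(\langle a_i, x\rangle), \qquad f(z) = \frac{e^z}{e^z+1}.$$ Let $\delta > 0$ and suppose that $$m \ge C \delta^{-2} s \log(2n/s).$$ Then, with probability at least $1 - 8\exp(-c\delta^2 m)$, the convex program $$\max\ \sum_{i=1}^m y_i \langle a_i, x'\rangle \quad \text{subject to} \quad \|x'\|_1 \le \sqrt{s},\ \|x'\|_2 \le 1$$ has a solution, and every solution $\hat{x}$ of it satisfies $$\Big\| \hat{x} - \frac{x}{\|x\|_2} \Big\|_2^2 \le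 \delta \max\big(\|x\|_2^{-1}, 1\big).$$ -/

import Mathlib

open MeasureTheory ProbabilityTheory

noncomputable section

/-- The logistic function `f z = e ^ z / (e ^ z + 1)`. -/
def logisticFun (z : ℝ) : ℝ := Real.exp z / (Real.exp z + 1)

/-- The set `K_{n,s}` of approximately `s`-sparse vectors: Euclidean norm at most `1` and
`ℓ₁` norm at most `√s`. -/
def compressibleSet (n : ℕ) (s : ℝ) : Set (EuclideanSpace ℝ (Fin n)) :=
  {z | ‖z‖ ≤ 1 ∧ ∑ j, |z j| ≤ Real.sqrt s}

/-- `z` is a solution of the convex program: maximize `∑ i, y i * ⟪a i, z'⟫` subject to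
`‖z'‖₁ ≤ √s` and `‖z'‖₂ ≤ 1`. -/
def IsProgramSolution {n m : ℕ} (s : ℝ) (a : Fin m → EuclideanSpace ℝ (Fin n)) (y : Fin m → ℝ)
    (z : EuclideanSpace ℝ (Fin n)) : Prop :=
  z ∈ compressibleSet n s ∧
    IsMaxOn (fun z' => ∑ i, y i * inner ℝ (a i) z') (compressibleSet n s) z

/-- The σ-algebra generated by the measurement vectors `a 1, …, a m`. -/
abbrev measurementSigma {Ω : Type*} {n m : ℕ} (a : Fin m → Ω → EuclideanSpace ℝ (Fin n)) :
    MeasurableSpace Ω :=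
  ⨆ i, MeasurableSpace.comap (a i) inferInstance

/-- Conditional independence of real random variables `y i` given a σ-algebra `𝒜`. On standard Borel
spaces this is `ProbabilityTheory.iCondIndepFun`, by
`iCondIndepFun_iff_condExp_inter_preimage_eq_mul`; here no condition on `Ω` is imposed. -/
def CondIndepGiven {Ω ι : Type*} (𝒜 : MeasurableSpace Ω) [MeasurableSpace Ω] (μ : Measure Ω)
    (y : ι → Ω → ℝ) : Prop :=
  ∀ (S : Finset ι) (B : ι → Set ℝ), (∀ i ∈ S, MeasurableSet (B i)) →
    μ⟦⋂ i ∈ S, y i ⁻¹' B i | 𝒜⟧ =ᵐ[μ] ∏ i ∈ S, μ⟦y i ⁻¹' B i | 𝒜⟧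

/-- The logistic regression model with signal `x` and Gaussian design: the `a i` are independent
standard Gaussian vectors and, given the `a i`, the `y i` are independent `{-1, 1}`-valued random
variables with `ℙ(y i = 1) = f (⟪a i, x⟫)`. -/
structure IsGaussianLogisticModel {Ω : Type*} [MeasurableSpace Ω] (μ : Measure Ω) {n m : ℕ}
    (x : EuclideanSpace ℝ (Fin n)) (a : Fin m → Ω → EuclideanSpace ℝ (Fin n))
    (y : Fin m → Ω → ℝ) : Prop where
  measurable_a : ∀ i, Measurable (a i)
  measurable_y : ∀ i, Measurable (y i)
  gaussian_a : ∀ i, HasLaw (a i) (stdGaussian (EuclideanSpace ℝ (Fin n))) μ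
  indep_a : iIndepFun a μ
  sign_y : ∀ i ω, y i ω = -1 ∨ y i ω = 1
  condIndep_y : CondIndepGiven (measurementSigma a) μ y
  prob_y : ∀ i, μ⟦y i ⁻¹' {1} | measurementSigma a⟧ =ᵐ[μ]
    fun ω => logisticFun (inner ℝ (a i ω) x)

end

/-! ### The logistic function -/

/-! Write `u = x/‖x‖` and `V = ∑ yᵢ aᵢ - m λ u`, where `λ` is the mean of `yᵢ⟨aᵢ, u⟩`. Optimality of
`z` against the feasible point `u` bounds `m λ ‖z - u‖²` by four times the supremum of `⟨V, ·⟩` over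
the compressible set (`IsProgramSolution.norm_sub_sq_le`). A lower bound for the logistic function
gives `λ ≥ c₀ min(‖x‖, 1)` (`min_mul_le_labelCorr`), so that supremum must be shown to be at most of
order `c₀ δ m`.

Two facts do this. First, `V` is sub-Gaussian: a symmetrization and Jensen's inequality bound the
moment generating function of one `yᵢ aᵢ` (`labelMGF_le`), and conditioning on the `aᵢ` multiplies
these (`integral_exp_score`). Second, soft thresholding bounds the supremum by the `ℓ₂` norm of the
large part of `V`, whose exponential moment is found by averaging the moment generating function
over a random `θ` (`lintegral_prod_one_add_exp_sq_le`); Markov's inequality then gives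
`exists_event_inner_le`. No net or chaining is needed. -/

lemma logisticFun_pos (t : ℝ) : 0 < logisticFun t := by
  unfold logisticFun; positivity

lemma logisticFun_lt_one (t : ℝ) : logisticFun t < 1 := by
  unfold logisticFun
  rw [div_lt_one (by positivity)]
  linarith

lemma continuous_logisticFun : Continuous logisticFun := by
  unfold logisticFun
  exact Continuous.div (by fun_prop) (by fun_prop) fun t => by positivity

lemma logisticFun_neg (t : ℝ) : logisticFun (-t) = 1 - logisticFun t := by
  unfold logisticFun
  rw [Real.exp_neg]
  have := Real.exp_pos t
  field_simp
  ring

lemma div_two_add_le_two_mul_logisticFun_sub_one {w : ℝ} (hw : 0 ≤ w) :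
    w / (2 + w) ≤ 2 * logisticFun w - 1 := by
  have h1 : w + 1 ≤ Real.exp w := Real.add_one_le_exp w
  have h2 : 2 * logisticFun w - 1 = (Real.exp w - 1) / (Real.exp w + 1) := by
    unfold logisticFun
    have := Real.exp_pos w
    field_simp
    ring
  rw [h2, div_le_div_iff₀ (by positivity) (by positivity)]
  nlinarith

/-- Separates the signal strength `r` from the Gaussian variable `z`; the factor `min r 1` becomes
`max ‖x‖⁻¹ 1` in the final error. Both sides are even in `z`. -/
lemma min_mul_le_logisticFun_mul {r : ℝ} (hr : 0 < r) (z : ℝ) :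
    min r 1 * (z ^ 2 / (2 + |z|)) ≤ (2 * logisticFun (r * z) - 1) * z := by
  wlog hz : 0 ≤ z generalizing z
  · have := this (-z) (by linarith)
    rw [abs_neg, mul_neg, mul_neg, logisticFun_neg, neg_sq] at this
    linarith
  rw [abs_of_nonneg hz]
  have h1 := mul_le_mul_of_nonneg_right
    (div_two_add_le_two_mul_logisticFun_sub_one (mul_nonneg hr.le hz)) hz
  refine le_trans ?_ h1
  have h2 : min r 1 / (2 + z) ≤ r / (2 + r * z) := by
    rw [div_le_div_iff₀ (by positivity) (by positivity)]
    rcases le_total r 1 with h | h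
    · rw [min_eq_left h]
      nlinarith [mul_nonneg hr.le hz, mul_nonneg (mul_nonneg hr.le hz) (sub_nonneg.2 h)]
    · rw [min_eq_right h]
      nlinarith
  calc min r 1 * (z ^ 2 / (2 + z)) = min r 1 / (2 + z) * z ^ 2 := by ring
    _ ≤ r / (2 + r * z) * z ^ 2 := by gcongr
    _ = r * z / (2 + r * z) * z := by ring

/-! ### Gaussian computations -/

lemma integrable_sq_div_gaussianReal :
    Integrable (fun z : ℝ => z ^ 2 / (2 + |z|)) (gaussianReal 0 1) := by
  have h : Integrable (fun z : ℝ => |z|) (gaussianReal 0 1) :=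
    (IsGaussian.integrable_id (μ := gaussianReal 0 1)).abs
  refine h.mono' (by fun_prop : Measurable _).aestronglyMeasurable (ae_of_all _ fun z => ?_)
  rw [Real.norm_of_nonneg (by positivity), div_le_iff₀ (by positivity), ← sq_abs]
  nlinarith [abs_nonneg z]

lemma integral_sq_div_gaussianReal_pos :
    0 < ∫ z : ℝ, z ^ 2 / (2 + |z|) ∂(gaussianReal 0 1) := by
  rw [integral_pos_iff_support_of_nonneg (fun z => by positivity) integrable_sq_div_gaussianReal]
  have : Function.support (fun z : ℝ => z ^ 2 / (2 + |z|)) = {0}ᶜ := by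
    ext z
    have : (2 + |z|) ≠ 0 := by positivity
    simp [this]
  have hna := nullSingletonClass_gaussianReal (μ := 0) (one_ne_zero (α := NNReal))
  rw [this, prob_compl_eq_one_sub (measurableSet_singleton _)]
  simp

/-- With variance `1/(4M)` the density decays like `exp(-2Mh²)`, so half of the decay survives the
factor `exp(Mh²)`. -/
lemma integrable_exp_sq_gaussianReal {M : NNReal} (hM : 0 < M) :
    Integrable (fun h : ℝ => Real.exp (M * h ^ 2)) (gaussianReal 0 (4 * M)⁻¹) ∧
    ∫ h : ℝ, Real.exp (M * h ^ 2) ∂(gaussianReal 0 (4 * M)⁻¹) = Real.sqrt 2 := by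
  have hv : (4 * M)⁻¹ ≠ 0 := by positivity
  have hM' : (0 : ℝ) < M := hM
  have key : ∀ h : ℝ, gaussianPDFReal 0 (4 * M)⁻¹ h * Real.exp (M * h ^ 2) =
      (Real.sqrt (2 * Real.pi * (4 * M)⁻¹))⁻¹ * Real.exp (-M * h ^ 2) := by
    intro h
    rw [gaussianPDFReal, mul_assoc, ← Real.exp_add]
    push_cast
    congr 2
    field_simp
    ring
  constructor
  · rw [gaussianReal_of_var_ne_zero _ hv, integrable_withDensity_iff_integrable_smul']
    · simp only [gaussianPDF, ENNReal.toReal_ofReal (gaussianPDFReal_nonneg _ _ _), smul_eq_mul, key]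
      exact (integrable_exp_neg_mul_sq hM').const_mul _
    · exact measurable_gaussianPDF _ _
    · exact ae_of_all _ fun _ => gaussianPDF_lt_top
  · rw [integral_gaussianReal_eq_integral_smul hv]
    simp only [smul_eq_mul, key]
    rw [integral_const_mul, integral_gaussian, ← Real.sqrt_inv, ← Real.sqrt_mul (by positivity)]
    congr 1
    have := Real.pi_pos
    push_cast
    field_simp
    norm_num

section StdGaussian

variable {n : ℕ}

lemma map_inner_stdGaussian (θ : EuclideanSpace ℝ (Fin n)) :
    (stdGaussian (EuclideanSpace ℝ (Fin n))).map (fun g => inner ℝ g θ) = gaussianReal 0 (‖θ‖₊ ^ 2) := by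
  have h := IsGaussian.map_eq_gaussianReal (μ := stdGaussian (EuclideanSpace ℝ (Fin n))) (innerSL ℝ θ)
  rw [integral_strongDual_stdGaussian, variance_dual_stdGaussian] at h
  have h2 : (⇑(innerSL ℝ θ) : (EuclideanSpace ℝ (Fin n)) → ℝ) = fun g => inner ℝ g θ := by
    ext g; simp [real_inner_comm]
  rw [h2] at h
  rw [h]
  congr 1
  ext
  simp

lemma integrable_exp_inner_stdGaussian (θ : EuclideanSpace ℝ (Fin n)) :
    Integrable (fun g => Real.exp (inner ℝ g θ)) (stdGaussian (EuclideanSpace ℝ (Fin n))) := by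
  have h : Integrable (fun z : ℝ => Real.exp z) (gaussianReal 0 (‖θ‖₊ ^ 2)) := by
    simpa using integrable_exp_mul_gaussianReal (μ := 0) (v := ‖θ‖₊ ^ 2) 1
  rw [← map_inner_stdGaussian] at h
  exact h.comp_measurable (by fun_prop)

lemma integral_exp_inner_stdGaussian (θ : EuclideanSpace ℝ (Fin n)) :
    ∫ g, Real.exp (inner ℝ g θ) ∂(stdGaussian (EuclideanSpace ℝ (Fin n))) = Real.exp (‖θ‖ ^ 2 / 2) := by
  have h := mgf_gaussianReal (map_inner_stdGaussian θ) 1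
  simpa [mgf] using h

lemma integrable_inner_stdGaussian (θ : EuclideanSpace ℝ (Fin n)) :
    Integrable (fun g => inner ℝ g θ) (stdGaussian (EuclideanSpace ℝ (Fin n))) :=
  (IsGaussian.integrable_id (μ := stdGaussian (EuclideanSpace ℝ (Fin n)))).inner_const θ

end StdGaussian

/-! ### Tails of the support function of the set of compressible vectors -/

section SoftThreshold

/-- Split `|v j|` at level `τ`: the part below pairs with the `ℓ₁` constraint, the excess with the
`ℓ₂` constraint by Cauchy–Schwarz. -/
lemma sqrt_add_sq_sum_bound {n : ℕ} {s τ r : ℝ} (hτ : 0 ≤ τ) (hr : 0 ≤ r)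
    (v z : EuclideanSpace ℝ (Fin n)) (hz : z ∈ compressibleSet n s)
    (hv : ∑ j, max (|v j| - τ) 0 ^ 2 ≤ r ^ 2) :
    inner ℝ v z ≤ τ * Real.sqrt s + r := by
  have h1 : inner ℝ v z = ∑ j, v j * z j := by
    simp [PiLp.inner_apply, mul_comm]
  have h2 : ∀ j, v j * z j ≤ τ * |z j| + max (|v j| - τ) 0 * |z j| := fun j => by
    calc v j * z j ≤ |v j| * |z j| := by rw [← abs_mul]; exact le_abs_self _
      _ ≤ (τ + max (|v j| - τ) 0) * |z j| := by
        gcongr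
        linarith [le_max_left (|v j| - τ) 0]
      _ = _ := by ring
  have h3 : ∑ j, max (|v j| - τ) 0 * |z j| ≤ r := by
    have hz2 : ∑ j, |z j| ^ 2 ≤ 1 := by
      have := hz.1
      rw [EuclideanSpace.norm_eq, Real.sqrt_le_one] at this
      simpa using this
    refine abs_le_of_sq_le_sq' ?_ hr |>.2
    calc (∑ j, max (|v j| - τ) 0 * |z j|) ^ 2
        ≤ (∑ j, max (|v j| - τ) 0 ^ 2) * ∑ j, |z j| ^ 2 := Finset.sum_mul_sq_le_sq_mul_sq _ _ _
      _ ≤ r ^ 2 * 1 := by gcongr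
      _ = r ^ 2 := mul_one _
  calc inner ℝ v z ≤ ∑ j, (τ * |z j| + max (|v j| - τ) 0 * |z j|) := by
        rw [h1]; exact Finset.sum_le_sum fun j _ => h2 j
    _ = τ * ∑ j, |z j| + ∑ j, max (|v j| - τ) 0 * |z j| := by
        rw [Finset.sum_add_distrib, Finset.mul_sum]
    _ ≤ τ * Real.sqrt s + r := by
        gcongr
        exact hz.2

/-- Above the threshold, `(|v| - τ)² ≤ v² - τ²`; below it the factor is `1`. The sum of the two
cases covers both. -/
lemma exp_sum_softThreshold_le {ι : Type*} [Fintype ι] {κ τ : ℝ} (hκ : 0 ≤ κ) (hτ : 0 ≤ τ)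
    (v : ι → ℝ) :
    Real.exp (κ * ∑ j, max (|v j| - τ) 0 ^ 2) ≤
      ∏ j, (1 + Real.exp (-(κ * τ ^ 2)) * Real.exp (κ * v j ^ 2)) := by
  rw [Finset.mul_sum, Real.exp_sum]
  refine Finset.prod_le_prod (fun _ _ => (Real.exp_pos _).le) fun j _ => ?_
  rcases le_total (|v j| - τ) 0 with h | h
  · rw [max_eq_right h]
    simp only [ne_eq, OfNat.ofNat_ne_zero, not_false_eq_true, zero_pow, mul_zero, Real.exp_zero]
    linarith [mul_pos (Real.exp_pos (-(κ * τ ^ 2))) (Real.exp_pos (κ * v j ^ 2))]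
  · rw [max_eq_left h, ← Real.exp_add]
    have : κ * (|v j| - τ) ^ 2 ≤ -(κ * τ ^ 2) + κ * v j ^ 2 := by
      rw [← sq_abs (v j)]
      nlinarith [mul_nonneg hκ (mul_nonneg hτ h)]
    linarith [Real.exp_le_exp.2 this]

end SoftThreshold

/-! ### Exponential moments of squares by averaging over a random direction -/

section Mixture

/-- The mixture `δ₀ + q N(0, 1 / (4 M))`. -/
noncomputable def gaussianMixture (M q : NNReal) : Measure ℝ :=
  Measure.dirac 0 + q • gaussianReal 0 (4 * M)⁻¹

instance (M q : NNReal) : IsFiniteMeasure (gaussianMixture M q) := by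
  unfold gaussianMixture; infer_instance

lemma integral_gaussianMixture {M q : NNReal} {f : ℝ → ℝ}
    (hfi : Integrable f (gaussianReal 0 (4 * M)⁻¹)) :
    Integrable f (gaussianMixture M q) ∧ ∫ h, f h ∂(gaussianMixture M q) =
      f 0 + q * ∫ h, f h ∂(gaussianReal 0 (4 * M)⁻¹) := by
  have h1 : Integrable f (Measure.dirac (0 : ℝ)) := integrable_dirac (by simp)
  have h2 : Integrable f (q • gaussianReal 0 (4 * M)⁻¹) := hfi.smul_measure_nnreal
  refine ⟨h1.add_measure h2, ?_⟩
  unfold gaussianMixture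
  rw [integral_add_measure h1 h2, integral_dirac, integral_smul_nnreal_measure]
  rfl

lemma integral_exp_mul_gaussianMixture (M q : NNReal) (v : ℝ) :
    Integrable (fun h => Real.exp (h * v)) (gaussianMixture M q) ∧
    ∫ h, Real.exp (h * v) ∂(gaussianMixture M q) = 1 + q * Real.exp (v ^ 2 / (8 * M)) := by
  have hi := integrable_exp_mul_gaussianReal (μ := 0) (v := (4 * M)⁻¹) v
  have h1 := mgf_gaussianReal (p := gaussianReal 0 (4 * M)⁻¹) (X := id) Measure.map_id v
  simp only [mgf, id] at h1
  simp only [mul_comm v] at hi h1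
  refine ⟨(integral_gaussianMixture hi).1, ?_⟩
  rw [(integral_gaussianMixture hi).2, h1]
  simp only [zero_mul, Real.exp_zero]
  congr 3
  push_cast
  rw [mul_inv, zero_add, div_eq_mul_inv, div_eq_mul_inv, mul_inv]
  ring

/-- A random vector with sub-Gaussian moment generating function satisfies the same bound on
`E ∏ j, (1 + q * exp (V j ^ 2 / (8 * M)))` as a vector with independent Gaussian coordinates. -/
lemma lintegral_prod_one_add_exp_sq_le {Ω ι : Type*} [Fintype ι] [MeasurableSpace Ω] {μ : Measure Ω}
    [SFinite μ] {M : NNReal} (hM : 0 < M) (q : NNReal) {V : Ω → ι → ℝ} (hV : Measurable V)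
    (h : ∀ θ : ι → ℝ, ∫⁻ ω, ENNReal.ofReal (Real.exp (∑ j, θ j * V ω j)) ∂μ ≤
      ENNReal.ofReal (Real.exp (M * ∑ j, θ j ^ 2))) :
    ∫⁻ ω, ENNReal.ofReal (∏ j, (1 + q * Real.exp (V ω j ^ 2 / (8 * M)))) ∂μ ≤
      ENNReal.ofReal ((1 + q * Real.sqrt 2) ^ Fintype.card ι) := by
  set ζ := gaussianMixture M q
  have hexp : ∀ v : ι → ℝ, ENNReal.ofReal (∏ j, (1 + q * Real.exp (v j ^ 2 / (8 * M)))) =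
      ∫⁻ θ, ENNReal.ofReal (Real.exp (∑ j, θ j * v j)) ∂(Measure.pi fun _ : ι => ζ) := by
    intro v
    simp_rw [Real.exp_sum]
    rw [← ofReal_integral_eq_lintegral_ofReal, integral_fintype_prod_eq_prod
      (f := fun j h => Real.exp (h * v j))]
    · simp_rw [ζ, (integral_exp_mul_gaussianMixture M q _).2]
    · exact Integrable.fintype_prod (f := fun j h => Real.exp (h * v j)) fun j =>
        (integral_exp_mul_gaussianMixture M q _).1
    · exact ae_of_all _ fun θ => Finset.prod_nonneg fun _ _ => (Real.exp_pos _).le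
  have hsq := integral_gaussianMixture (q := q) (integrable_exp_sq_gaussianReal hM).1
  rw [(integrable_exp_sq_gaussianReal hM).2] at hsq
  -- The coordinates of `V` may be dependent, but those of `θ` are independent: after Tonelli and
  -- the hypothesis at fixed `θ`, the integrand factorizes.
  calc ∫⁻ ω, ENNReal.ofReal (∏ j, (1 + q * Real.exp (V ω j ^ 2 / (8 * M)))) ∂μ
      = ∫⁻ ω, ∫⁻ θ, ENNReal.ofReal (Real.exp (∑ j, θ j * V ω j))
          ∂(Measure.pi fun _ : ι => ζ) ∂μ := by simp_rw [hexp]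
    _ = ∫⁻ θ, ∫⁻ ω, ENNReal.ofReal (Real.exp (∑ j, θ j * V ω j)) ∂μ
          ∂(Measure.pi fun _ : ι => ζ) := by
        refine lintegral_lintegral_swap (Measurable.aemeasurable ?_)
        unfold Function.uncurry
        fun_prop
    _ ≤ ∫⁻ θ, ENNReal.ofReal (∏ j, Real.exp (M * θ j ^ 2)) ∂(Measure.pi fun _ : ι => ζ) := by
        refine lintegral_mono fun θ => ?_
        rw [← Real.exp_sum, ← Finset.mul_sum]
        exact h θ
    _ = ENNReal.ofReal ((1 + q * Real.sqrt 2) ^ Fintype.card ι) := by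
        rw [← ofReal_integral_eq_lintegral_ofReal, integral_fintype_prod_eq_prod
          (f := fun _ h => Real.exp (M * h ^ 2))]
        · simp [ζ, hsq.2]
        · exact Integrable.fintype_prod (f := fun (_ : ι) h => Real.exp (M * h ^ 2)) fun _ => hsq.1
        · exact ae_of_all _ fun θ => Finset.prod_nonneg fun _ _ => (Real.exp_pos _).le

end Mixture

/-! ### One measurement of the logistic model -/

section OneMeasurement

variable {n : ℕ}

/-- The sign attached to a label. -/
def labelSign (b : Bool) : ℝ := if b then 1 else -1

/-- The probability of a label in the logistic model, given the value of the linear predictor. -/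
noncomputable def labelProb (b : Bool) (t : ℝ) : ℝ := if b then logisticFun t else 1 - logisticFun t

lemma labelProb_nonneg (b : Bool) (t : ℝ) : 0 ≤ labelProb b t := by
  cases b
  · simpa [labelProb] using (logisticFun_lt_one t).le
  · simpa [labelProb] using (logisticFun_pos t).le

lemma labelProb_le_one (b : Bool) (t : ℝ) : labelProb b t ≤ 1 := by
  cases b
  · simpa [labelProb] using (logisticFun_pos t).le
  · simpa [labelProb] using (logisticFun_lt_one t).le

lemma continuous_labelProb (b : Bool) : Continuous (labelProb b) := by
  cases b
  · exact (continuous_const.sub continuous_logisticFun :)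
  · exact (continuous_logisticFun :)

/-- The correlation of the label with the measurement in the direction `θ`. -/
noncomputable def labelCorr (x θ : EuclideanSpace ℝ (Fin n)) : ℝ :=
  ∫ g, (2 * logisticFun (inner ℝ g x) - 1) * inner ℝ g θ ∂(stdGaussian (EuclideanSpace ℝ (Fin n)))

lemma integrable_labelCorr (x θ : EuclideanSpace ℝ (Fin n)) :
    Integrable (fun g => (2 * logisticFun (inner ℝ g x) - 1) * inner ℝ g θ)
      (stdGaussian (EuclideanSpace ℝ (Fin n))) := by
  refine (integrable_inner_stdGaussian θ).bdd_mul (c := 1) ?_ (ae_of_all _ fun g => ?_)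
  · have := continuous_logisticFun
    exact Continuous.aestronglyMeasurable (by fun_prop)
  · rw [Real.norm_eq_abs, abs_le]
    constructor <;> linarith [logisticFun_pos (inner ℝ g x), logisticFun_lt_one (inner ℝ g x)]

/-- The reflection fixing the line of `x` preserves the Gaussian law and the label, so only the
component of `θ` along `x` contributes. -/
lemma labelCorr_eq (x θ : EuclideanSpace ℝ (Fin n)) :
    labelCorr x θ = labelCorr x (‖x‖⁻¹ • x) * inner ℝ (‖x‖⁻¹ • x) θ := by
  set u := ‖x‖⁻¹ • x with hu
  set R := (Submodule.span ℝ {x}).reflection with hR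
  have hRx : R x = x := Submodule.reflection_mem_subspace_eq_self (Submodule.mem_span_singleton_self x)
  have hRθ : R θ = (2 * inner ℝ u θ) • u - θ := by
    rw [hR, Submodule.reflection_singleton_apply, hu]
    rw [two_smul, ← two_smul ℝ, smul_smul, smul_smul, real_inner_smul_left]
    congr 2
    simp only [RCLike.ofReal_real_eq_id, id]
    rw [div_eq_mul_inv, sq, mul_inv]
    ring
  have hsymm : ∀ g v, inner ℝ (R g) v = inner ℝ g (R v) := fun g v => by
    rw [← R.inner_map_map, hR, Submodule.reflection_reflection]
  have h1 : labelCorr x θ = ∫ g, (2 * logisticFun (inner ℝ g x) - 1) *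
      ((2 * inner ℝ u θ) * inner ℝ g u - inner ℝ g θ)
        ∂(stdGaussian (EuclideanSpace ℝ (Fin n))) := by
    unfold labelCorr
    conv_lhs => rw [← stdGaussian_map R]
    rw [integral_map (by fun_prop)]
    · refine integral_congr_ae (ae_of_all _ fun g => ?_)
      simp only [hsymm, hRx, hRθ, inner_sub_right, real_inner_smul_right]
    · have := continuous_logisticFun
      exact Continuous.aestronglyMeasurable (by fun_prop)
  have h2 : labelCorr x θ = (2 * inner ℝ u θ) * labelCorr x u - labelCorr x θ := by
    conv_lhs => rw [h1]
    unfold labelCorr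
    rw [← integral_const_mul, ← integral_sub ((integrable_labelCorr x u).const_mul _)
      (integrable_labelCorr x θ)]
    refine integral_congr_ae (ae_of_all _ fun g => ?_)
    ring
  linarith

lemma min_mul_le_labelCorr {x : EuclideanSpace ℝ (Fin n)} (hx : x ≠ 0) :
    min ‖x‖ 1 * ∫ z : ℝ, z ^ 2 / (2 + |z|) ∂(gaussianReal 0 1) ≤ labelCorr x (‖x‖⁻¹ • x) := by
  have hr : 0 < ‖x‖ := norm_pos_iff.2 hx
  have hmap := map_inner_stdGaussian (‖x‖⁻¹ • x)
  have h1 : ‖(‖x‖⁻¹ • x)‖₊ ^ 2 = 1 := by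
    ext
    simp [norm_smul, hr.ne']
  rw [h1] at hmap
  have hcont := continuous_logisticFun
  have hinner : ∀ g : EuclideanSpace ℝ (Fin n),
      inner ℝ g x = ‖x‖ * inner ℝ g (‖x‖⁻¹ • x) := fun g => by
    rw [real_inner_smul_right, mul_inv_cancel_left₀ hr.ne']
  have hcomp : (fun g : EuclideanSpace ℝ (Fin n) =>
      (2 * logisticFun (inner ℝ g x) - 1) * inner ℝ g (‖x‖⁻¹ • x)) =
      (fun z : ℝ => (2 * logisticFun (‖x‖ * z) - 1) * z) ∘ fun g => inner ℝ g (‖x‖⁻¹ • x) := by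
    ext g
    simp only [Function.comp, hinner g]
  have hmeas : AEStronglyMeasurable (fun z : ℝ => (2 * logisticFun (‖x‖ * z) - 1) * z)
      ((stdGaussian (EuclideanSpace ℝ (Fin n))).map fun g => inner ℝ g (‖x‖⁻¹ • x)) :=
    Continuous.aestronglyMeasurable (by fun_prop)
  have hint := integrable_labelCorr x (‖x‖⁻¹ • x)
  rw [hcomp, ← integrable_map_measure hmeas (by fun_prop), hmap] at hint
  have h2 : labelCorr x (‖x‖⁻¹ • x) =
      ∫ z, (2 * logisticFun (‖x‖ * z) - 1) * z ∂(gaussianReal 0 1) := by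
    rw [← hmap, integral_map (by fun_prop) hmeas]
    simp_rw [labelCorr, hinner]
  rw [h2, ← integral_const_mul]
  exact integral_mono (integrable_sq_div_gaussianReal.const_mul _) hint
    fun z => min_mul_le_logisticFun_mul hr z

/-- The moment generating function of `y • a`, where `y` is the label of the measurement `a`. -/
noncomputable def labelMGF (x θ : EuclideanSpace ℝ (Fin n)) : ℝ :=
  ∑ b, ∫ g, labelProb b (inner ℝ g x) * Real.exp (labelSign b * inner ℝ g θ)
    ∂(stdGaussian (EuclideanSpace ℝ (Fin n)))

lemma integrable_labelMGF (x θ : EuclideanSpace ℝ (Fin n)) (b : Bool) :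
    Integrable (fun g => labelProb b (inner ℝ g x) * Real.exp (labelSign b * inner ℝ g θ))
      (stdGaussian (EuclideanSpace ℝ (Fin n))) := by
  refine Integrable.bdd_mul (c := 1) ?_ ?_ (ae_of_all _ fun g => ?_)
  · simpa [real_inner_smul_right] using integrable_exp_inner_stdGaussian (labelSign b • θ)
  · have := continuous_labelProb b
    exact Continuous.aestronglyMeasurable (by fun_prop)
  · rw [Real.norm_of_nonneg (labelProb_nonneg _ _)]
    exact labelProb_le_one _ _

/-- The two label probabilities sum to `1`, so the logistic function cancels. -/
lemma labelMGF_add_labelMGF_neg (x θ : EuclideanSpace ℝ (Fin n)) :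
    labelMGF x θ + labelMGF x (-θ) = 2 * Real.exp (‖θ‖ ^ 2 / 2) := by
  have h1 := integral_exp_inner_stdGaussian θ
  have h2 := integral_exp_inner_stdGaussian (-θ)
  rw [norm_neg] at h2
  have h3 : ∀ θ, ∑ b, ∫ g, labelProb b (inner ℝ g x) * Real.exp (labelSign b * inner ℝ g θ)
      ∂(stdGaussian (EuclideanSpace ℝ (Fin n))) = labelMGF x θ := fun θ => rfl
  rw [← h3, ← h3, two_mul]
  nth_rw 1 [← h1]
  rw [← h2, ← integral_add (integrable_exp_inner_stdGaussian _)
    (integrable_exp_inner_stdGaussian _),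
    ← integral_finsetSum _ fun b _ => integrable_labelMGF x θ b,
    ← integral_finsetSum _ fun b _ => integrable_labelMGF x (-θ) b,
    ← integral_add (integrable_finsetSum _ fun b _ => integrable_labelMGF x θ b)
      (integrable_finsetSum _ fun b _ => integrable_labelMGF x (-θ) b)]
  refine integral_congr_ae (ae_of_all _ fun g => ?_)
  simp [labelProb, labelSign]
  ring

/-- Jensen's inequality, through the tangent line of `exp` at the mean. -/
lemma exp_labelCorr_le_labelMGF (x θ : EuclideanSpace ℝ (Fin n)) :
    Real.exp (labelCorr x θ) ≤ labelMGF x θ := by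
  set l := labelCorr x θ with hl
  have h1 : ∫ g, Real.exp l * (1 - l + (2 * logisticFun (inner ℝ g x) - 1) * inner ℝ g θ)
      ∂(stdGaussian (EuclideanSpace ℝ (Fin n))) = Real.exp l := by
    rw [integral_const_mul, integral_add (integrable_const _) (integrable_labelCorr x θ)]
    have : ∫ g, (2 * logisticFun (inner ℝ g x) - 1) * inner ℝ g θ
      ∂(stdGaussian (EuclideanSpace ℝ (Fin n))) = l := rfl
    rw [this]
    simp
  rw [← h1]
  unfold labelMGF
  rw [← integral_finsetSum _ fun b _ => integrable_labelMGF x θ b]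
  refine integral_mono (((integrable_const _).add (integrable_labelCorr x θ)).const_mul _)
    (integrable_finsetSum _ fun b _ => integrable_labelMGF x θ b) fun g => ?_
  have hexp : ∀ c, Real.exp l * (1 - l + c) ≤ Real.exp c := fun c => by
    rw [← sub_add_cancel c l, Real.exp_add, mul_comm]
    gcongr
    linarith [Real.add_one_le_exp (c - l)]
  have hp := mul_le_mul_of_nonneg_left (hexp (inner ℝ g θ)) (logisticFun_pos (inner ℝ g x)).le
  have hn := mul_le_mul_of_nonneg_left (hexp (-inner ℝ g θ))
    (sub_nonneg.2 (logisticFun_lt_one (inner ℝ g x)).le)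
  simp only [Fintype.sum_bool, labelProb, labelSign, if_true, one_mul, Bool.false_eq_true, if_false,
    neg_mul]
  refine le_trans (le_of_eq ?_) (add_le_add hp hn)
  ring

/-- By AM-GM the values at `θ` and `-θ` have product at most `exp(‖θ‖²)`; Jensen's lower bound at
`-θ` turns this into an upper bound at `θ` with the exact mean in the exponent. -/
lemma labelMGF_le (x θ : EuclideanSpace ℝ (Fin n)) :
    labelMGF x θ ≤ Real.exp (‖θ‖ ^ 2 + labelCorr x θ) := by
  have h1 := labelMGF_add_labelMGF_neg x θ
  have h2 := exp_labelCorr_le_labelMGF x (-θ)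
  have h3 : labelCorr x (-θ) = -labelCorr x θ := by
    simp [labelCorr, integral_neg]
  rw [h3] at h2
  have h4 : labelMGF x θ * labelMGF x (-θ) ≤ Real.exp (‖θ‖ ^ 2) := by
    have : Real.exp (‖θ‖ ^ 2) = Real.exp (‖θ‖ ^ 2 / 2) ^ 2 := by
      rw [← Real.exp_nat_mul]; congr 1; push_cast; ring
    have h4 : Real.exp (‖θ‖ ^ 2 / 2) = (labelMGF x θ + labelMGF x (-θ)) / 2 := by linarith
    rw [this, h4]
    nlinarith [sq_nonneg (labelMGF x θ - labelMGF x (-θ))]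
  have h5 : 0 ≤ labelMGF x θ := (Real.exp_pos _).le.trans (exp_labelCorr_le_labelMGF x θ)
  calc labelMGF x θ = labelMGF x θ * Real.exp (-labelCorr x θ) * Real.exp (labelCorr x θ) := by
        rw [mul_assoc, ← Real.exp_add, neg_add_cancel, Real.exp_zero, mul_one]
    _ ≤ labelMGF x θ * labelMGF x (-θ) * Real.exp (labelCorr x θ) := by gcongr
    _ ≤ Real.exp (‖θ‖ ^ 2 + labelCorr x θ) := by rw [Real.exp_add]; gcongr

end OneMeasurement

/-! ### The moment generating function of the score -/

lemma measurable_measurementSigma {Ω : Type*} {n m : ℕ}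
    (a : Fin m → Ω → EuclideanSpace ℝ (Fin n)) (i : Fin m) :
    Measurable[measurementSigma a] (a i) :=
  measurable_iff_comap_le.2 (le_iSup (fun i => MeasurableSpace.comap (a i) inferInstance) i)

namespace IsGaussianLogisticModel

variable {Ω : Type*} [MeasurableSpace Ω] {μ : Measure Ω} {n m : ℕ}
  {x : EuclideanSpace ℝ (Fin n)} {a : Fin m → Ω → EuclideanSpace ℝ (Fin n)} {y : Fin m → Ω → ℝ}

lemma measurementSigma_le (h : IsGaussianLogisticModel μ x a y) :
    measurementSigma a ≤ ‹MeasurableSpace Ω› :=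
  iSup_le fun i => (h.measurable_a i).comap_le

/-- The event that the labels follow the pattern `σ`. -/
def labelEvent (y : Fin m → Ω → ℝ) (σ : Fin m → Bool) : Set Ω :=
  ⋂ i ∈ Finset.univ, y i ⁻¹' {labelSign (σ i)}

lemma measurableSet_labelEvent (h : IsGaussianLogisticModel μ x a y) (σ : Fin m → Bool) :
    MeasurableSet (labelEvent y σ) :=
  Finset.measurableSet_biInter _ fun i _ => h.measurable_y i (measurableSet_singleton _)

/-- Exactly one sign pattern occurs at each `ω`. Each summand is a function of the `a i` times an
indicator, ready for conditioning. -/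
lemma exp_score_eq_sum (h : IsGaussianLogisticModel μ x a y) (θ : EuclideanSpace ℝ (Fin n))
    (ω : Ω) :
    Real.exp (∑ i, y i ω * inner ℝ (a i ω) θ) =
      ∑ σ : Fin m → Bool, (∏ i, Real.exp (labelSign (σ i) * inner ℝ (a i ω) θ)) *
        (labelEvent y σ).indicator (fun _ => (1 : ℝ)) ω := by
  classical
  set σ₀ : Fin m → Bool := fun i => decide (y i ω = 1) with hσ₀
  have hy : ∀ i, y i ω = labelSign (σ₀ i) := fun i => by
    rcases h.sign_y i ω with hi | hi <;> simp [hσ₀, labelSign, hi]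
  have hinj : ∀ b c, labelSign b = labelSign c → b = c := by
    intro b c; cases b <;> cases c <;> simp [labelSign] <;> norm_num
  rw [Finset.sum_eq_single σ₀]
  · rw [Set.indicator_of_mem (by simp [labelEvent, hy]), mul_one, ← Real.exp_sum]
    simp_rw [hy]
  · intro σ _ hσ
    rw [Set.indicator_of_notMem, mul_zero]
    intro hmem
    refine hσ (funext fun i => hinj _ _ ?_)
    have : y i ω = labelSign (σ i) := by
      simp only [labelEvent, Finset.mem_univ, Set.iInter_true, Set.mem_iInter] at hmem
      exact hmem i
    rw [← this, hy]
  · simp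

variable [IsProbabilityMeasure μ]

lemma condExp_label (h : IsGaussianLogisticModel μ x a y) (i : Fin m) (b : Bool) :
    μ⟦y i ⁻¹' {labelSign b} | measurementSigma a⟧ =ᵐ[μ]
      fun ω => labelProb b (inner ℝ (a i ω) x) := by
  cases b
  · have hcompl : (y i ⁻¹' {labelSign false}).indicator (fun _ => (1 : ℝ)) =
        (fun _ => (1 : ℝ)) - (y i ⁻¹' {1}).indicator (fun _ => (1 : ℝ)) := by
      ext ω
      rcases h.sign_y i ω with hy | hy <;>
        simp [Set.indicator, labelSign, hy] <;> norm_num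
    have hint : Integrable ((y i ⁻¹' {1}).indicator (fun _ => (1 : ℝ))) μ :=
      (integrable_const _).indicator (h.measurable_y i (measurableSet_singleton _))
    rw [hcompl]
    filter_upwards [condExp_sub (integrable_const (1 : ℝ)) hint (measurementSigma a), h.prob_y i]
      with ω h1 h2
    rw [h1, Pi.sub_apply, h2, condExp_const h.measurementSigma_le]
    simp [labelProb]
  · exact h.prob_y i

lemma condExp_labelEvent (h : IsGaussianLogisticModel μ x a y) (σ : Fin m → Bool) :
    μ⟦labelEvent y σ | measurementSigma a⟧ =ᵐ[μ]
      fun ω => ∏ i, labelProb (σ i) (inner ℝ (a i ω) x) := by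
  have h1 := h.condIndep_y Finset.univ (fun i => {labelSign (σ i)})
    fun i _ => measurableSet_singleton _
  have h2 : ∀ᵐ ω ∂μ, ∀ i, (μ⟦y i ⁻¹' {labelSign (σ i)} | measurementSigma a⟧) ω =
      labelProb (σ i) (inner ℝ (a i ω) x) := ae_all_iff.2 fun i => h.condExp_label i (σ i)
  filter_upwards [h1, h2] with ω h1 h2
  rw [labelEvent, h1, Finset.prod_apply]
  exact Finset.prod_congr rfl fun i _ => h2 i

lemma integrable_exp_sum (h : IsGaussianLogisticModel μ x a y) (σ : Fin m → Bool)
    (θ : EuclideanSpace ℝ (Fin n)) :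
    Integrable (fun ω => ∏ i, Real.exp (labelSign (σ i) * inner ℝ (a i ω) θ)) μ := by
  have hind := h.indep_a.comp (fun i v => labelSign (σ i) * inner ℝ v θ) fun i => by fun_prop
  have h1 := hind.integrable_exp_mul_sum (t := 1) (s := Finset.univ)
    (fun i => by have := h.measurable_a i; simp only [Function.comp_def]; fun_prop) fun i _ => ?_
  · simpa [Function.comp_def, Real.exp_sum] using h1
  · have h2 := integrable_exp_inner_stdGaussian (labelSign (σ i) • θ)
    rw [← (h.gaussian_a i).map_eq] at h2
    have := h2.comp_measurable (h.measurable_a i)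
    simpa [Function.comp_def, real_inner_smul_right] using this

/-- Condition on the `a i`: the exponentials pull out, the indicator becomes a product of label
probabilities, and independence of the `a i` splits the integral. -/
lemma integral_indicator_mul_exp (h : IsGaussianLogisticModel μ x a y) (σ : Fin m → Bool)
    (θ : EuclideanSpace ℝ (Fin n)) :
    ∫ ω, (∏ i, Real.exp (labelSign (σ i) * inner ℝ (a i ω) θ)) *
        (labelEvent y σ).indicator (fun _ => (1 : ℝ)) ω ∂μ =
      ∏ i, ∫ g, labelProb (σ i) (inner ℝ g x) * Real.exp (labelSign (σ i) * inner ℝ g θ)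
        ∂(stdGaussian (EuclideanSpace ℝ (Fin n))) := by
  set G : Ω → ℝ := fun ω => ∏ i, Real.exp (labelSign (σ i) * inner ℝ (a i ω) θ) with hG
  have hGmeas : StronglyMeasurable[measurementSigma a] G := by
    refine Measurable.stronglyMeasurable (Finset.measurable_prod _ fun i _ => ?_)
    have hc : Measurable fun v : EuclideanSpace ℝ (Fin n) =>
      Real.exp (labelSign (σ i) * inner ℝ v θ) := by fun_prop
    exact hc.comp (measurable_measurementSigma a i)
  have hA : Integrable ((labelEvent y σ).indicator (fun _ => (1 : ℝ))) μ :=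
    (integrable_const _).indicator (h.measurableSet_labelEvent σ)
  have hGA : Integrable (G * (labelEvent y σ).indicator (fun _ => (1 : ℝ))) μ := by
    have := (h.integrable_exp_sum σ θ).indicator (h.measurableSet_labelEvent σ)
    refine this.congr (ae_of_all _ fun ω => ?_)
    by_cases hω : ω ∈ labelEvent y σ <;> simp [hω, hG]
  have h1 := condExp_mul_of_stronglyMeasurable_left hGmeas hGA hA
  change ∫ ω, (G * (labelEvent y σ).indicator (fun _ => (1 : ℝ))) ω ∂μ = _
  rw [← integral_condExp h.measurementSigma_le, integral_congr_ae h1]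
  have hind := h.indep_a.integral_fun_prod_comp
    (f := fun i v => labelProb (σ i) (inner ℝ v x) * Real.exp (labelSign (σ i) * inner ℝ v θ))
    (fun i => (h.measurable_a i).aemeasurable) fun i => by
      have := continuous_labelProb (σ i)
      exact Continuous.aestronglyMeasurable (by fun_prop)
  have hlaw : ∀ i, ∫ ω, labelProb (σ i) (inner ℝ (a i ω) x) *
      Real.exp (labelSign (σ i) * inner ℝ (a i ω) θ) ∂μ =
      ∫ g, labelProb (σ i) (inner ℝ g x) * Real.exp (labelSign (σ i) * inner ℝ g θ)
        ∂(stdGaussian (EuclideanSpace ℝ (Fin n))) := fun i => by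
    rw [← (h.gaussian_a i).map_eq, integral_map (h.measurable_a i).aemeasurable]
    have := continuous_labelProb (σ i)
    exact Continuous.aestronglyMeasurable (by fun_prop)
  simp_rw [← hlaw]
  rw [← hind]
  refine integral_congr_ae ?_
  filter_upwards [h.condExp_labelEvent σ] with ω hω
  rw [Pi.mul_apply, hω, mul_comm, ← Finset.prod_mul_distrib]

lemma integral_exp_score (h : IsGaussianLogisticModel μ x a y) (θ : EuclideanSpace ℝ (Fin n)) :
    Integrable (fun ω => Real.exp (∑ i, y i ω * inner ℝ (a i ω) θ)) μ ∧
    ∫ ω, Real.exp (∑ i, y i ω * inner ℝ (a i ω) θ) ∂μ = labelMGF x θ ^ m := by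
  have hint : ∀ σ : Fin m → Bool,
      Integrable (fun ω => (∏ i, Real.exp (labelSign (σ i) * inner ℝ (a i ω) θ)) *
        (labelEvent y σ).indicator (fun _ => (1 : ℝ)) ω) μ := fun σ => by
    have := (h.integrable_exp_sum σ θ).indicator (h.measurableSet_labelEvent σ)
    refine this.congr (ae_of_all _ fun ω => ?_)
    by_cases hω : ω ∈ labelEvent y σ <;> simp [hω]
  simp_rw [h.exp_score_eq_sum θ]
  refine ⟨integrable_finsetSum _ fun σ _ => hint σ, ?_⟩
  rw [integral_finsetSum _ fun σ _ => hint σ]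
  simp_rw [h.integral_indicator_mul_exp _ θ]
  have := Finset.prod_univ_sum (fun _ : Fin m => (Finset.univ : Finset Bool))
    (fun _ b => ∫ g, labelProb b (inner ℝ g x) * Real.exp (labelSign b * inner ℝ g θ)
        ∂(stdGaussian (EuclideanSpace ℝ (Fin n))))
  rw [Fintype.piFinset_univ] at this
  rw [← this]
  simp [labelMGF]

/-- The centred score `∑ i, y i • a i - m λ x / ‖x‖` is sub-Gaussian. -/
lemma lintegral_exp_centred_score_le (h : IsGaussianLogisticModel μ x a y)
    (θ : EuclideanSpace ℝ (Fin n)) :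
    ∫⁻ ω, ENNReal.ofReal (Real.exp (inner ℝ ((∑ i, y i ω • a i ω) -
        (m * labelCorr x (‖x‖⁻¹ • x)) • (‖x‖⁻¹ • x)) θ)) ∂μ ≤
      ENNReal.ofReal (Real.exp (m * ‖θ‖ ^ 2)) := by
  have hpt : ∀ ω, Real.exp (inner ℝ ((∑ i, y i ω • a i ω) -
        (m * labelCorr x (‖x‖⁻¹ • x)) • (‖x‖⁻¹ • x)) θ) =
      Real.exp (-(m * labelCorr x θ)) * Real.exp (∑ i, y i ω * inner ℝ (a i ω) θ) := fun ω => by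
    rw [← Real.exp_add, inner_sub_left, sum_inner, labelCorr_eq x θ, real_inner_smul_left]
    simp_rw [real_inner_smul_left]
    congr 1
    ring
  obtain ⟨hi, hI⟩ := h.integral_exp_score θ
  simp_rw [hpt]
  rw [← ofReal_integral_eq_lintegral_ofReal (hi.const_mul _) (ae_of_all _ fun ω => by positivity),
    integral_const_mul, hI]
  refine ENNReal.ofReal_le_ofReal ?_
  have h0 : 0 ≤ labelMGF x θ := (Real.exp_pos _).le.trans (exp_labelCorr_le_labelMGF x θ)
  calc Real.exp (-(m * labelCorr x θ)) * labelMGF x θ ^ m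
      ≤ Real.exp (-(m * labelCorr x θ)) * Real.exp (‖θ‖ ^ 2 + labelCorr x θ) ^ m := by
        gcongr
        exact labelMGF_le x θ
    _ = Real.exp (m * ‖θ‖ ^ 2) := by
        rw [← Real.exp_nat_mul, ← Real.exp_add]
        congr 1
        ring

end IsGaussianLogisticModel

/-! ### The convex program -/

section Program

variable {n : ℕ} {s : ℝ}

lemma neg_mem_compressibleSet {z : EuclideanSpace ℝ (Fin n)} (hz : z ∈ compressibleSet n s) :
    -z ∈ compressibleSet n s := by
  simpa [compressibleSet] using hz

lemma isCompact_compressibleSet : IsCompact (compressibleSet n s) := by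
  refine Metric.isCompact_of_isClosed_isBounded ?_ ?_
  · exact (isClosed_le continuous_norm continuous_const).inter
      (isClosed_le (f := fun z : EuclideanSpace ℝ (Fin n) => ∑ j, |z j|) (by fun_prop)
        continuous_const)
  · refine (Metric.isBounded_closedBall (x := 0) (r := 1)).subset fun z hz => ?_
    simpa using hz.1

lemma one_le_of_mem_compressibleSet {u : EuclideanSpace ℝ (Fin n)} (hu : ‖u‖ = 1)
    (h : u ∈ compressibleSet n s) : 1 ≤ s := by
  have h1 : (1 : ℝ) ≤ ∑ j, |u j| := by
    calc (1 : ℝ) = ∑ j, |u j| * |u j| := by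
          have := EuclideanSpace.norm_sq_eq u
          rw [hu] at this
          simpa [sq] using this
      _ ≤ ∑ j, |u j| * 1 := by
          gcongr with j
          simpa [hu] using PiLp.norm_apply_le u j
      _ = ∑ j, |u j| := by simp
  exact Real.one_le_sqrt.1 (h1.trans h.2)

lemma exists_isProgramSolution {m : ℕ} (h : (compressibleSet n s).Nonempty)
    (a : Fin m → EuclideanSpace ℝ (Fin n)) (y : Fin m → ℝ) : ∃ z, IsProgramSolution s a y z :=
  isCompact_compressibleSet.exists_isMaxOn h (by fun_prop)

/-- Optimality gives `l (1 - ⟨u, z⟩) ≤ ⟨V, z⟩ + ⟨V, -u⟩ ≤ 2t`, with `V` the centred score, and `‖z -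
u‖² ≤ 2 (1 - ⟨u, z⟩)` since `‖z‖ ≤ 1`. -/
lemma IsProgramSolution.norm_sub_sq_le {m : ℕ} {a : Fin m → EuclideanSpace ℝ (Fin n)}
    {y : Fin m → ℝ} {z u : EuclideanSpace ℝ (Fin n)} (hz : IsProgramSolution s a y z)
    (hu : ‖u‖ = 1) (huK : u ∈ compressibleSet n s) {l t : ℝ} (hl : 0 ≤ l)
    (hV : ∀ w ∈ compressibleSet n s, inner ℝ ((∑ i, y i • a i) - l • u) w ≤ t) :
    l * ‖z - u‖ ^ 2 ≤ 4 * t := by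
  have h1 : inner ℝ (∑ i, y i • a i) u ≤ inner ℝ (∑ i, y i • a i) z := by
    simpa [sum_inner, real_inner_smul_left] using hz.2 huK
  have h2 := hV z hz.1
  have h3 := hV (-u) (neg_mem_compressibleSet huK)
  simp only [inner_sub_left, inner_neg_right, real_inner_smul_left, real_inner_self_eq_norm_sq,
    hu] at h2 h3
  have h4 : ‖z - u‖ ^ 2 ≤ 2 - 2 * inner ℝ u z := by
    rw [norm_sub_sq_real, hu, real_inner_comm]
    nlinarith [hz.1.1, norm_nonneg z]
  nlinarith [mul_le_mul_of_nonneg_left h4 hl]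

end Program

/-! ### Uniform deviation bound over compressible vectors -/

section Tail

/-- If `V` is a random vector with sub-Gaussian moment generating function, then off an event of
probability at most `exp (s - r ^ 2 / (8 * m))` its support function on the set of compressible
vectors is at most `2 * r`. -/
lemma exists_event_inner_le {Ω : Type*} [MeasurableSpace Ω] {μ : Measure Ω}
    [IsProbabilityMeasure μ] {n m : ℕ} (hm : 0 < m) {s r : ℝ} (hs : 0 < s) (hsn : s ≤ n)
    (hr : 0 ≤ r) (hsr : 8 * m * (s * Real.log (2 * n / s)) ≤ r ^ 2)
    {V : Ω → EuclideanSpace ℝ (Fin n)} (hV : Measurable V)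
    (h : ∀ θ, ∫⁻ ω, ENNReal.ofReal (Real.exp (inner ℝ (V ω) θ)) ∂μ ≤
      ENNReal.ofReal (Real.exp (m * ‖θ‖ ^ 2))) :
    ∃ E : Set Ω, MeasurableSet E ∧ 1 - Real.exp (s - r ^ 2 / (8 * m)) ≤ μ.real E ∧
      ∀ ω ∈ E, ∀ z ∈ compressibleSet n s, inner ℝ (V ω) z ≤ 2 * r := by
  have hn : (0 : ℝ) < n := hs.trans_le hsn
  have hm' : (0 : ℝ) < m := by exact_mod_cast hm
  have hL : 0 ≤ Real.log (2 * n / s) := Real.log_nonneg (by rw [le_div_iff₀ hs]; linarith)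
  set κ : ℝ := (8 * m)⁻¹ with hκ
  have hκ0 : 0 < κ := by positivity
  -- Chosen so that `exp(-κτ²) = s/(2n)`: the product of `n` factors then has mean at most `exp s`,
  -- while `τ√s ≤ r` is exactly `hsr`.
  set τ : ℝ := Real.sqrt (8 * m * Real.log (2 * n / s)) with hτ
  have hκτ : κ * τ ^ 2 = Real.log (2 * n / s) := by
    rw [hτ, Real.sq_sqrt (by positivity), hκ]
    field_simp
  set q : NNReal := ⟨s / (2 * n), by positivity⟩ with hq
  have hq' : Real.exp (-(κ * τ ^ 2)) = q := by
    rw [hκτ, Real.exp_neg, Real.exp_log (by positivity), inv_div]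
    rfl
  set F : Ω → ℝ := fun ω => ∏ j, (1 + q * Real.exp (V ω j ^ 2 / (8 * m))) with hF
  have hFmeas : Measurable F := by fun_prop
  have hFint : ∫⁻ ω, ENNReal.ofReal (F ω) ∂μ ≤ ENNReal.ofReal (Real.exp s) := by
    have h1 := lintegral_prod_one_add_exp_sq_le (μ := μ) (M := m) (by exact_mod_cast hm) q
      (V := fun ω j => V ω j) (by fun_prop) fun θ => by
        have := h (WithLp.toLp 2 θ)
        simpa [PiLp.inner_apply, EuclideanSpace.norm_sq_eq] using this
    refine h1.trans (ENNReal.ofReal_le_ofReal ?_)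
    rw [Fintype.card_fin]
    calc (1 + q * Real.sqrt 2) ^ n ≤ Real.exp (q * Real.sqrt 2) ^ n := by
          gcongr
          linarith [Real.add_one_le_exp (q * Real.sqrt 2)]
      _ = Real.exp (n * (s / (2 * n) * Real.sqrt 2)) := by
          rw [← Real.exp_nat_mul]; rfl
      _ ≤ Real.exp s := by
          have h2 : Real.sqrt 2 ≤ 2 := by
            rw [Real.sqrt_le_left (by norm_num)]; norm_num
          have h3 : n * (s / (2 * n) * Real.sqrt 2) = s * (Real.sqrt 2 / 2) := by
            field_simp
          rw [h3]
          gcongr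
          nlinarith
  set E : Set Ω := {ω | F ω ≤ Real.exp (κ * r ^ 2)} with hE
  have hEmeas : MeasurableSet E := measurableSet_le hFmeas measurable_const
  refine ⟨E, hEmeas, ?_, fun ω hω z hz => ?_⟩
  · have hcompl : μ.real Eᶜ ≤ Real.exp (s - r ^ 2 / (8 * m)) := by
      have h1 : ENNReal.ofReal (Real.exp (κ * r ^ 2)) * μ Eᶜ ≤ ENNReal.ofReal (Real.exp s) := by
        refine le_trans ?_ ((mul_meas_ge_le_lintegral hFmeas.ennreal_ofReal
          (ENNReal.ofReal (Real.exp (κ * r ^ 2)))).trans hFint)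
        gcongr
        intro ω hω
        exact ENNReal.ofReal_le_ofReal (not_le.1 (show ¬F ω ≤ _ from hω)).le
      have h2 := ENNReal.toReal_mono ENNReal.ofReal_ne_top h1
      rw [ENNReal.toReal_mul, ENNReal.toReal_ofReal (Real.exp_pos _).le,
        ENNReal.toReal_ofReal (Real.exp_pos _).le] at h2
      rw [Real.exp_sub, le_div_iff₀ (Real.exp_pos _), mul_comm, div_eq_inv_mul]
      exact h2
    rw [probReal_compl_eq_one_sub hEmeas] at hcompl
    linarith
  · have h1 : Real.exp (κ * ∑ j, max (|V ω j| - τ) 0 ^ 2) ≤ Real.exp (κ * r ^ 2) := by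
      refine (exp_sum_softThreshold_le hκ0.le (Real.sqrt_nonneg _) _).trans ?_
      rw [hq']
      simpa [hE, hF, div_eq_inv_mul, hκ] using hω
    have h2 := le_of_mul_le_mul_left (Real.exp_le_exp.1 h1) hκ0
    refine (sqrt_add_sq_sum_bound (Real.sqrt_nonneg _) hr _ z hz h2).trans ?_
    have h3 : τ * Real.sqrt s ≤ r := by
      rw [hτ, ← Real.sqrt_mul (by positivity), Real.sqrt_le_left hr]
      linarith
    linarith

end Tail

/-! ### The recovery theorem -/

theorem mainTheorem5 :
    ∃ C : ℝ, 0 < C ∧ ∃ c : ℝ, 0 < c ∧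
      ∀ (Ω : Type*) [MeasurableSpace Ω] (μ : Measure Ω) [IsProbabilityMeasure μ]
        (n m : ℕ) (s : ℝ), s ≤ n →
        ∀ x : EuclideanSpace ℝ (Fin n), x ≠ 0 → ‖x‖⁻¹ • x ∈ compressibleSet n s →
        ∀ (a : Fin m → Ω → EuclideanSpace ℝ (Fin n)) (y : Fin m → Ω → ℝ),
        IsGaussianLogisticModel μ x a y →
        ∀ δ : ℝ, 0 < δ → C * δ⁻¹ ^ 2 * s * Real.log (2 * n / s) ≤ m →
        ∃ E : Set Ω, MeasurableSet E ∧ 1 - 8 * Real.exp (-(c * δ ^ 2 * m)) ≤ μ.real E ∧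
          ∀ ω ∈ E,
            (∃ z, IsProgramSolution s (fun i => a i ω) (fun i => y i ω) z) ∧
            ∀ z, IsProgramSolution s (fun i => a i ω) (fun i => y i ω) z →
              ‖z - ‖x‖⁻¹ • x‖ ^ 2 ≤ δ * max ‖x‖⁻¹ 1 := by
  set c₀ := ∫ z : ℝ, z ^ 2 / (2 + |z|) ∂(gaussianReal 0 1) with hc₀
  have hc₀_pos : 0 < c₀ := integral_sq_div_gaussianReal_pos
  have hlog2 : 0 < Real.log 2 := Real.log_pos (by norm_num)
  refine ⟨1024 / (c₀ ^ 2 * Real.log 2), by positivity, c₀ ^ 2 / 1024, by positivity, ?_⟩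
  intro Ω _ μ _ n m s hsn x hx hxK a y h δ hδ hCm
  have hx0 : 0 < ‖x‖ := norm_pos_iff.2 hx
  set u := ‖x‖⁻¹ • x with hu
  have hu1 : ‖u‖ = 1 := by rw [hu, norm_smul, norm_inv, norm_norm, inv_mul_cancel₀ hx0.ne']
  have hs1 : 1 ≤ s := one_le_of_mem_compressibleSet hu1 hxK
  have hs : 0 < s := by linarith
  set L := Real.log (2 * n / s) with hL
  have hL2 : Real.log 2 ≤ L :=
    Real.log_le_log (by norm_num) (by rw [le_div_iff₀ hs]; linarith)
  have hsL : 1024 * (s * L) ≤ c₀ ^ 2 * δ ^ 2 * m * Real.log 2 := by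
    have h1 : 1024 / (c₀ ^ 2 * Real.log 2) * δ⁻¹ ^ 2 * s * L =
        1024 * (s * L) / (c₀ ^ 2 * δ ^ 2 * Real.log 2) := by
      field_simp
    rw [h1, div_le_iff₀ (by positivity)] at hCm
    linarith
  have hm' : (0 : ℝ) < m := by
    by_contra hm0
    have hm0 : (m : ℝ) = 0 := le_antisymm (not_lt.1 hm0) (Nat.cast_nonneg m)
    rw [hm0] at hsL
    nlinarith [mul_pos hs (hlog2.trans_le hL2)]
  have hm : 0 < m := by exact_mod_cast hm'
  have hlog2' : Real.log 2 ≤ 1 := by linarith [Real.log_two_lt_d9]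
  set lam := labelCorr x u with hlam
  have hlam_ge : min ‖x‖ 1 * c₀ ≤ lam := min_mul_le_labelCorr hx
  have hmin : 0 < min ‖x‖ 1 := lt_min hx0 one_pos
  have hlam_pos : 0 < lam := (mul_pos hmin hc₀_pos).trans_le hlam_ge
  -- Makes `4 * (2 * r) = m * c₀ * δ`, the error allowed by the optimality bound.
  set r := c₀ * δ * m / 8 with hr
  have hr2 : r ^ 2 = c₀ ^ 2 * δ ^ 2 * m * m / 64 := by rw [hr]; ring
  have hB : 0 < c₀ ^ 2 * δ ^ 2 * m := by positivity
  obtain ⟨E, hE, hEμ, hEV⟩ := exists_event_inner_le (μ := μ) hm hs hsn (r := r) (by positivity)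
    (by
      rw [hr2, ← hL]
      have h1 : 512 * (s * L) ≤ c₀ ^ 2 * δ ^ 2 * m := by
        nlinarith [mul_pos hs (hlog2.trans_le hL2)]
      nlinarith)
    (V := fun ω => (∑ i, y i ω • a i ω) - (m * lam) • u)
    (by
      have h1 := h.measurable_a
      have h2 := h.measurable_y
      fun_prop)
    fun θ => h.lintegral_exp_centred_score_le θ
  refine ⟨E, hE, le_trans ?_ hEμ, fun ω hω => ⟨exists_isProgramSolution ⟨u, hxK⟩ _ _, ?_⟩⟩
  -- Since `L ≥ log 2`, the term `s` uses up at most half of `r²/(8m) = c₀²δ²m/512`. The bound holds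
  -- with prefactor `1`, stronger than `8`.
  · have h1 : s ≤ c₀ ^ 2 * δ ^ 2 * m / 1024 := by
      have h2 : 1024 * s * Real.log 2 ≤ c₀ ^ 2 * δ ^ 2 * m * Real.log 2 := by nlinarith
      linarith [le_of_mul_le_mul_right h2 hlog2]
    have h2 : r ^ 2 / (8 * m) = c₀ ^ 2 * δ ^ 2 * m / 512 := by
      rw [hr2]; field_simp; norm_num
    have h3 : Real.exp (s - r ^ 2 / (8 * m)) ≤ Real.exp (-(c₀ ^ 2 / 1024 * δ ^ 2 * m)) := by
      rw [h2]
      gcongr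
      linarith
    linarith [Real.exp_pos (-(c₀ ^ 2 / 1024 * δ ^ 2 * m))]
  · intro z hz
    have h1 := hz.norm_sub_sq_le hu1 hxK (l := m * lam) (by positivity) (hEV ω hω)
    have h2 : min ‖x‖ 1 * ‖z - u‖ ^ 2 ≤ δ := by
      have h3 : (m * c₀) * (min ‖x‖ 1 * ‖z - u‖ ^ 2) ≤ (m * c₀) * δ := by
        calc (m * c₀) * (min ‖x‖ 1 * ‖z - u‖ ^ 2) = m * (min ‖x‖ 1 * c₀) * ‖z - u‖ ^ 2 := by ring
          _ ≤ m * lam * ‖z - u‖ ^ 2 := by gcongr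
          _ ≤ 4 * (2 * r) := h1
          _ = (m * c₀) * δ := by rw [hr]; ring
      exact le_of_mul_le_mul_left h3 (by positivity)
    have h4 : 1 ≤ min ‖x‖ 1 * max ‖x‖⁻¹ 1 := by
      rcases le_total ‖x‖ 1 with hx1 | hx1
      · rw [min_eq_left hx1]
        calc 1 = ‖x‖ * ‖x‖⁻¹ := (mul_inv_cancel₀ hx0.ne').symm
          _ ≤ _ := by gcongr; exact le_max_left _ _
      · rw [min_eq_right hx1, one_mul]
        exact le_max_right _ _
    calc ‖z - u‖ ^ 2 = 1 * ‖z - u‖ ^ 2 := (one_mul _).symm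
      _ ≤ min ‖x‖ 1 * max ‖x‖⁻¹ 1 * ‖z - u‖ ^ 2 := by gcongr
      _ = min ‖x‖ 1 * ‖z - u‖ ^ 2 * max ‖x‖⁻¹ 1 := by ring
      _ ≤ δ * max ‖x‖⁻¹ 1 := by gcongr
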